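/- Let $\Delta$ be a $(d-1)$-dimensional simplex with $d \ge 4$, linearly embedded in a real vector space, and let $\Gamma$ be a finite geometric triangulation of $\Delta$, i.e. a finite geometric simplicial complex whose underlying space is $\Delta$. For each face $F \le \Delta$ (including $F = \varnothing$ and $F = \Delta$) let $\Gamma_F$ be the restriction of $\Gamma$ to $F$, i.e. the subcomplex of all faces of $\Gamma$ contained in $F$. Its $h$-polynomial $h(\Gamma_F;x)=\sum_i h_i x^i$ is defined by $$\sum_{i=0}^{d_F} h_i\,(x+1)^{d_F-i} = \sum_{i=0}^{d_F} f_{i-1}\,x^{d_F-i},\qquad d_F=\dim F+1,$$ where $f_{-1}=1$ and $f_i$ is the number of $i$-dimensional faces of $\Gamma_F$. The local $h$-polynomial of $\Gamma$ is $$\ell(\Gamma;x)=\sum_{i=0}^{d}\ell_i x^i=\sum_{F\le\Delta}(-1)^{\dim\Delta-\dim F}\,h(\Gamma_F;x)$$ (with $\dim\varnothing=-1$). An interior edge of $\Gamma$ is a one-dimensional face of $\Gamma$ that is not contained in any proper face of $\Delta$. A facet $G$ of $\Gamma$ (a maximal face) is called a pyramid if some proper face of $\Delta$ contains every vertex of $G$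 except one. Proposition. If $\ell_1=\ell_2=0$, then every facet $G$ of $\Gamma$ that contains an interior edge is a pyramid. -/

import Mathlib

namespace LocalH

open Geometry Polynomial

variable {E : Type*} [AddCommGroup E] [Module ℝ E]

/-- `K` is a (geometric, finite) triangulation of the simplex whose vertex set is the affinely
independent set `Δ`. The faces of the simplex are the convex hulls of the subsets of `Δ`
(including `∅`), and its dimension is `Δ.card - 1`. -/
structure IsTriangulation (K : SimplicialComplex ℝ E) (Δ : Finset E) : Prop where
  affineIndependent : AffineIndependent ℝ ((↑) : Δ → E)
  finite_faces : K.faces.Finite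
  space_eq : K.space = convexHull ℝ (Δ : Set E)

/-- The restriction of `K` to the simplex with vertex set `F`: the subcomplex of all faces of `K`
that are contained in that simplex. -/
def restrict (K : SimplicialComplex ℝ E) (F : Finset E) : SimplicialComplex ℝ E where
  faces := {s | s ∈ K.faces ∧ (s : Set E) ⊆ convexHull ℝ (F : Set E)}
  isRelLowerSet_faces := fun _ hs =>
    ⟨K.nonempty_of_mem_faces hs.1, fun _ hts ht =>
      ⟨K.down_closed hs.1 hts ht, (Finset.coe_subset.2 hts).trans hs.2⟩⟩
  indep := fun hs => K.indep hs.1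
  inter_subset_convexHull := fun hs ht => K.inter_subset_convexHull hs.1 ht.1

/-- The number `f_{i-1}` of faces of `K` with exactly `i` vertices, that is, of dimension `i - 1`.
The empty face, which Mathlib does not list among the faces of a complex, is counted here, so that
`f_{-1} = 1`. -/
noncomputable def faceCount (K : SimplicialComplex ℝ E) (i : ℕ) : ℕ :=
  {s : Finset E | (s = ∅ ∨ s ∈ K.faces) ∧ s.card = i}.ncard

/-- The `h`-polynomial of `K`, viewed as a complex of dimension `d - 1`. It is characterized by
`∑ h_i (x + 1) ^ (d - i) = ∑ f_{i-1} x ^ (d - i)`, see `sum_coeff_hPoly`. -/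
noncomputable def hPoly (K : SimplicialComplex ℝ E) (d : ℕ) : ℤ[X] :=
  ∑ i ∈ Finset.range (d + 1), (faceCount K i : ℤ[X]) * (X ^ i * (1 - X) ^ (d - i))

/-- The local `h`-polynomial of a triangulation `K` of the simplex with vertex set `Δ`: the
alternating sum of the `h`-polynomials of the restrictions of `K` to the faces `F` of the simplex,
with sign `(-1) ^ codim F`. See `sum_localH` and `localH_empty` for its characterization by
Möbius inversion. -/
noncomputable def localH (K : SimplicialComplex ℝ E) (Δ : Finset E) : ℤ[X] :=
  ∑ F ∈ Δ.powerset, (-1) ^ (Δ.card - F.card) * hPoly (restrict K F) F.card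

/-- `F` is the smallest face of the simplex with vertex set `Δ` that contains the simplex with
vertex set `s`. -/
def IsCarriedBy (Δ s F : Finset E) : Prop :=
  F ⊆ Δ ∧ (s : Set E) ⊆ convexHull ℝ (F : Set E) ∧
    ∀ F' ⊆ Δ, (s : Set E) ⊆ convexHull ℝ (F' : Set E) → F ⊆ F'

/-- `e` is an interior edge of `K`: a one-dimensional face that is carried by the whole simplex. -/
def IsInteriorEdge (K : SimplicialComplex ℝ E) (Δ e : Finset E) : Prop :=
  e ∈ K.faces ∧ e.card = 2 ∧ IsCarriedBy Δ e Δ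

/-- The simplex with vertex set `G` is a pyramid: some proper face of the simplex with vertex set
`Δ` contains every vertex of `G` except exactly one. -/
def IsPyramid (Δ G : Finset E) : Prop :=
  ∃ F ⊂ Δ, ∃ v ∈ G, v ∉ convexHull ℝ (F : Set E) ∧
    ∀ w ∈ G, w ≠ v → w ∈ convexHull ℝ (F : Set E)

/-! ### The characterizations of the `h`-polynomial and the local `h`-polynomial -/

theorem sum_coeff_basis (n j : ℕ) :
    (∀ i, n + j < i → (X ^ j * (1 - X) ^ n : ℤ[X]).coeff i = 0) ∧
    ∑ i ∈ Finset.range (n + j + 1),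
      C ((X ^ j * (1 - X) ^ n : ℤ[X]).coeff i) * (X + 1) ^ (n + j - i) = (X : ℤ[X]) ^ n := by
  induction n with
  | zero =>
    refine ⟨fun i hi => ?_, ?_⟩
    · simp [coeff_X_pow]; omega
    · simp [coeff_X_pow, Finset.sum_ite_eq']
  | succ n ih =>
    obtain ⟨ih0, ih1⟩ := ih
    have key : (X ^ j * (1 - X) ^ (n + 1) : ℤ[X])
        = X ^ j * (1 - X) ^ n - X ^ j * (1 - X) ^ n * X := by ring
    rw [key]
    generalize (X ^ j * (1 - X) ^ n : ℤ[X]) = p at ih0 ih1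
    refine ⟨fun i hi => ?_, ?_⟩
    · obtain ⟨i, rfl⟩ : ∃ k, i = k + 1 := ⟨i - 1, by omega⟩
      rw [coeff_sub, coeff_mul_X, ih0 _ (by omega), ih0 _ (by omega), sub_zero]
    · simp only [coeff_sub, C_sub, sub_mul, Finset.sum_sub_distrib]
      have e1 : ∑ i ∈ Finset.range (n + 1 + j + 1),
          C (p.coeff i) * (X + 1 : ℤ[X]) ^ (n + 1 + j - i) = (X + 1) * X ^ n := by
        rw [← ih1, show n + 1 + j + 1 = n + j + 1 + 1 by omega, Finset.sum_range_succ,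
          ih0 (n + j + 1) (by omega), C_0, zero_mul, add_zero, Finset.mul_sum]
        refine Finset.sum_congr rfl fun i hi => ?_
        have : i ≤ n + j := by simpa [Nat.lt_succ_iff] using hi
        rw [show n + 1 + j - i = n + j - i + 1 by omega, pow_succ]
        ring
      have e2 : ∑ i ∈ Finset.range (n + 1 + j + 1),
          C ((p * X).coeff i) * (X + 1 : ℤ[X]) ^ (n + 1 + j - i) = X ^ n := by
        rw [← ih1, show n + 1 + j + 1 = n + j + 1 + 1 by omega, Finset.sum_range_succ']
        simp only [coeff_mul_X, coeff_mul_X_zero, C_0, zero_mul, add_zero]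
        refine Finset.sum_congr rfl fun i _ => ?_
        rw [show n + 1 + j - (i + 1) = n + j - i by omega]
      rw [e1, e2]
      ring

theorem sum_coeff_hPoly (K : SimplicialComplex ℝ E) (d : ℕ) :
    ∑ i ∈ Finset.range (d + 1), C ((hPoly K d).coeff i) * (X + 1 : ℤ[X]) ^ (d - i)
      = ∑ i ∈ Finset.range (d + 1), (faceCount K i : ℤ[X]) * X ^ (d - i) := by
  have h (i : ℕ) : (hPoly K d).coeff i = ∑ j ∈ Finset.range (d + 1),
      (faceCount K j : ℤ) * (X ^ j * (1 - X) ^ (d - j) : ℤ[X]).coeff i := by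
    simp only [hPoly, finsetSum_coeff, ← Int.cast_natCast (R := ℤ[X]), ← C_eq_intCast, coeff_C_mul,
      Int.cast_id]
  simp only [h, map_sum, Finset.sum_mul]
  rw [Finset.sum_comm]
  refine Finset.sum_congr rfl fun j hj => ?_
  have hjd : d - j + j = d := by have := Finset.mem_range.1 hj; omega
  have := (sum_coeff_basis (d - j) j).2
  rw [hjd] at this
  rw [← this, Finset.mul_sum]
  refine Finset.sum_congr rfl fun i _ => ?_
  simp only [C_mul, mul_assoc]
  simp

theorem restrict_restrict (K : SimplicialComplex ℝ E) {F G : Finset E} (h : G ⊆ F) :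
    restrict (restrict K F) G = restrict K G := by
  ext s
  exact ⟨fun hs => ⟨hs.1.1, hs.2⟩,
    fun hs => ⟨⟨hs.1, hs.2.trans (convexHull_mono (Finset.coe_subset.2 h))⟩, hs.2⟩⟩

theorem restrict_self {K : SimplicialComplex ℝ E} {Δ : Finset E} (h : IsTriangulation K Δ) :
    restrict K Δ = K := by
  ext s
  exact ⟨fun hs => hs.1, fun hs => ⟨hs, (K.subset_space hs).trans h.space_eq.subset⟩⟩

theorem localH_empty (K : SimplicialComplex ℝ E) : localH (restrict K ∅) ∅ = 1 := by
  have : {s : Finset E | (s = ∅ ∨ s ∈ (restrict (restrict K ∅) ∅).faces) ∧ s.card = 0} = {∅} := by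
    ext s
    simp only [Finset.card_eq_zero, Set.mem_ofPred_eq, Set.mem_singleton_iff]
    tauto
  have h0 : faceCount (restrict (restrict K ∅) ∅) 0 = 1 := by
    rw [faceCount, this, Set.ncard_singleton]
  simp [localH, hPoly, h0]

theorem sum_localH {K : SimplicialComplex ℝ E} {Δ : Finset E} (h : IsTriangulation K Δ) :
    hPoly K Δ.card = ∑ F ∈ Δ.powerset, localH (restrict K F) F := by
  classical
  have e1 : ∑ F ∈ Δ.powerset, localH (restrict K F) F = ∑ F ∈ Δ.powerset, ∑ G ∈ F.powerset,
      (-1) ^ (F.card - G.card) * hPoly (restrict K G) G.card := by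
    refine Finset.sum_congr rfl fun F _ => Finset.sum_congr rfl fun G hG => ?_
    rw [restrict_restrict K (Finset.mem_powerset.1 hG)]
  rw [e1, Finset.sum_comm' (t' := Δ.powerset) (s' := fun G => Finset.Icc G Δ)]
  · rw [Finset.sum_eq_single_of_mem Δ (Finset.mem_powerset_self Δ)]
    · simp [restrict_self h]
    · intro G hG hne
      have hG' := Finset.mem_powerset.1 hG
      rw [← Finset.sum_mul, Finset.Icc_eq_image_powerset hG', Finset.sum_image]
      · have e2 : ∀ H ∈ (Δ \ G).powerset,
            (-1 : ℤ[X]) ^ ((G ∪ H).card - G.card) = (((-1) ^ H.card : ℤ) : ℤ[X]) := by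
          intro H hH
          have hd : Disjoint G H := (Finset.disjoint_sdiff (s := G) (t := Δ)).mono_right
            (Finset.mem_powerset.1 hH)
          rw [Finset.card_union_of_disjoint hd]
          simp
        rw [Finset.sum_congr rfl e2, ← Int.cast_sum,
          Finset.sum_powerset_neg_one_pow_card_of_nonempty]
        · simp
        · rw [Finset.sdiff_nonempty]
          exact fun hs => hne (hG'.antisymm hs)
      · intro A hA B hB hAB
        have hA' := Finset.mem_powerset.1 (Finset.mem_coe.1 hA)
        have hB' := Finset.mem_powerset.1 (Finset.mem_coe.1 hB)
        ext x
        have := congrArg (x ∈ ·) hAB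
        have h1 := @hA' x
        have h2 := @hB' x
        simp only [Finset.mem_union, Finset.mem_sdiff, eq_iff_iff] at this h1 h2
        tauto
  · intro F G
    simp only [Finset.mem_powerset, Finset.mem_Icc]
    exact ⟨fun hh => ⟨⟨hh.2, hh.1⟩, hh.2.trans hh.1⟩, fun hh => ⟨hh.1.2, hh.1.1⟩⟩

end LocalH

/-! Barycentric coordinates turn `Γ` into a subdivision of the nonnegative orthant into simplicial
cones (`conicalSubdivision`). By Möbius inversion over the faces of `Δ`, the coefficient `ℓ₁` counts
interior vertices. When it vanishes, `ℓ₂` is the number of interior edges minus the number of facet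
vertices, i.e. vertices in the relative interior of a facet of `Δ` (`localH_coeff_one`,
`localH_coeff_two`). The hypotheses thus make these two numbers equal.

Send a function `f` on the facet vertices, extended by zero, to the function `f a + f b` on the
interior edges `ab`. This map is injective (`eq_zero_of_adj_add_eq_zero`): a nonzero kernel element
would trap a ray parallel to a coordinate axis inside the orthant (`not_absorbing`). Equal
dimensions make it surjective, so the interior edges are independent. This excludes four-cycles and
short paths between vertices that are not facet vertices. A second ray argument, which needs a
fourth coordinate, excludes triangles inside a face (`not_triangle`).

If a face `G` with an interior edge were not a pyramid, every coordinate positive at one vertex of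
`G` would be positive at another. Starting from the interior edge, this produces a forbidden
triangle or four-cycle (`exists_unique_pos_of_card_eq`). -/

/-! ### Subdivisions of the orthant and the ray argument. -/

/-- A family of simplicial cones in `ι → ℝ`, spanned by the vectors `vec v` for `v` in a face,
that subdivides the nonnegative orthant. -/
structure ConicalSubdivision (ι α : Type*) where
  vec : α → ι → ℝ
  faces : Set (Finset α)
  finite_faces : faces.Finite
  down_closed : ∀ {s t : Finset α}, s ∈ faces → t ⊆ s → t ∈ faces
  vec_nonneg : ∀ {s : Finset α} {v : α}, s ∈ faces → v ∈ s → ∀ i, 0 ≤ vec v i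
  linearIndependent : ∀ {s : Finset α}, s ∈ faces → LinearIndependent ℝ (fun v : s => vec v)
  cover : ∀ x : ι → ℝ, (∀ i, 0 ≤ x i) →
    ∃ s ∈ faces, ∃ w : α → ℝ, (∀ v ∈ s, 0 ≤ w v) ∧ ∑ v ∈ s, w v • vec v = x
  -- The intersection axiom of a complex: a relative interior point of one cone lies in another cone
  -- only if the first is a face of the second.
  subset_of_sum_eq : ∀ {s t : Finset α} {w w' : α → ℝ}, s ∈ faces → t ∈ faces →
    (∀ v ∈ s, 0 < w v) → (∀ v ∈ t, 0 ≤ w' v) →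
    ∑ v ∈ s, w v • vec v = ∑ v ∈ t, w' v • vec v → s ⊆ t

namespace ConicalSubdivision

variable {ι α : Type*} (K : ConicalSubdivision ι α)

/-- The cone spanned by the vectors of `s`. -/
def cone (s : Finset α) : Set (ι → ℝ) :=
  {x | ∃ w : α → ℝ, (∀ v ∈ s, 0 ≤ w v) ∧ ∑ v ∈ s, w v • K.vec v = x}

/-- Linear independence makes the cone the image of a closed orthant under an injective linear map,
which is a closed embedding in finite dimension. -/
theorem isClosed_cone [Finite ι] {s : Finset α} (hs : s ∈ K.faces) : IsClosed (K.cone s) := by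
  classical
  have hinj := K.linearIndependent hs
  let L : (s → ℝ) →ₗ[ℝ] (ι → ℝ) := Fintype.linearCombination ℝ (fun v : s => K.vec v)
  have hL : Function.Injective L := by
    simpa [LinearIndependent] using hinj.fintypeLinearCombination_injective
  have hc : Topology.IsClosedEmbedding L :=
    LinearMap.isClosedEmbedding_of_injective (LinearMap.ker_eq_bot.2 hL)
  have : K.cone s = L '' {w | ∀ v, 0 ≤ w v} := by
    ext x
    constructor
    · rintro ⟨w, hw, rfl⟩
      refine ⟨fun v => w v, fun v => hw v v.2, ?_⟩
      simp only [L, Fintype.linearCombination_apply]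
      exact Finset.sum_coe_sort s (fun v => w v • K.vec v)
    · rintro ⟨w, hw, rfl⟩
      refine ⟨fun v => if h : v ∈ s then w ⟨v, h⟩ else 0, fun v hv => by simpa [hv] using hw _, ?_⟩
      rw [← Finset.sum_coe_sort]
      simp [L, Fintype.linearCombination_apply]
  rw [this]
  refine hc.isClosedMap _ ?_
  simp only [Set.ofPred_forall]
  exact isClosed_iInter fun v => isClosed_le continuous_const (continuous_apply v)

theorem isClosed_biUnion_cone [Finite ι] {U : Set (Finset α)} (hU : U ⊆ K.faces) :
    IsClosed (⋃ s ∈ U, K.cone s) :=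
  (K.finite_faces.subset hU).isClosed_biUnion fun _ hs => K.isClosed_cone (hU hs)

theorem exists_support {t : Finset α} {x : ι → ℝ} (hx : x ∈ K.cone t) :
    ∃ s ⊆ t, ∃ w : α → ℝ, (∀ v ∈ s, 0 < w v) ∧ ∑ v ∈ s, w v • K.vec v = x := by
  classical
  obtain ⟨w, hw, rfl⟩ := hx
  refine ⟨t.filter (fun v => 0 < w v), Finset.filter_subset _ _, w,
    fun v hv => (Finset.mem_filter.1 hv).2, ?_⟩
  rw [Finset.sum_filter]
  refine Finset.sum_congr rfl fun v hv => ?_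
  split_ifs with h
  · rfl
  · rw [le_antisymm (not_lt.1 h) (hw v hv), zero_smul]

theorem exists_pos_of_sum_pos {s : Finset α} {w : α → ℝ} (hw : ∀ v ∈ s, 0 ≤ w v) {i : ι}
    (h : 0 < (∑ v ∈ s, w v • K.vec v) i) :
    ∃ v ∈ s, 0 < K.vec v i := by
  by_contra! hc
  refine h.not_ge ?_
  rw [Finset.sum_apply]
  exact Finset.sum_nonpos fun v hv => mul_nonpos_of_nonneg_of_nonpos (hw v hv) (hc v hv)

/-- Let `U` be a nonempty set of faces. If the support of every point on a ray with direction
`-e_r` that lies in the union of the cones over `U` is off the hyperplane `x_r = 0` and has only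
faces in `U` around it, then the ray never leaves the orthant, which is absurd. -/
theorem not_absorbing [Fintype ι] [DecidableEq ι] {U : Set (Finset α)} (hU : U ⊆ K.faces)
    {G : Finset α} (hG : G ∈ U) {g : ι → ℝ} (hg : g ∈ K.cone G) (r : ι)
    (h : ∀ t ∈ U, ∀ s ⊆ t, ∀ w : α → ℝ, (∀ v ∈ s, 0 < w v) →
      (∀ i ≠ r, (∑ v ∈ s, w v • K.vec v) i = g i) →
      (∃ v ∈ s, 0 < K.vec v r) ∧ ∀ t' ∈ K.faces, s ⊆ t' → t' ∈ U) : False := by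
  have hgnonneg : ∀ t ∈ U, ∀ x ∈ K.cone t, ∀ i, 0 ≤ x i := by
    rintro t ht x ⟨w, hw, rfl⟩ i
    rw [Finset.sum_apply]
    exact Finset.sum_nonneg fun v hv => mul_nonneg (hw v hv) (K.vec_nonneg (hU ht) hv i)
  let p : ℝ → ι → ℝ := fun c => g - c • Pi.single r 1
  have hp : Continuous p := by fun_prop
  have hpr : ∀ c, p c r = g r - c := fun c => by simp [p]
  have hpi : ∀ c i, i ≠ r → p c i = g i := fun c i hi => by simp [p, hi]
  let A : Set ℝ := Set.Icc 0 (g r) ∩ p ⁻¹' (⋃ s ∈ U, K.cone s)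
  have hA : IsCompact A :=
    isCompact_Icc.inter_right ((K.isClosed_biUnion_cone hU).preimage hp)
  have h0 : (0 : ℝ) ∈ A := by
    refine ⟨⟨le_rfl, hgnonneg G hG g hg r⟩, ?_⟩
    simp only [Set.mem_preimage, Set.mem_iUnion, p, zero_smul, sub_zero]
    exact ⟨G, hG, hg⟩
  -- The last moment `c` at which the ray meets the cones over `U`.
  obtain ⟨c, hc, hmax⟩ := hA.exists_isGreatest ⟨0, h0⟩
  obtain ⟨⟨hc0, hcg⟩, hcU⟩ := hc
  simp only [Set.mem_preimage, Set.mem_iUnion] at hcU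
  obtain ⟨t, ht, hct⟩ := hcU
  obtain ⟨s, hst, w, hw, hs⟩ := K.exists_support hct
  obtain ⟨⟨u, hu, hur⟩, habs⟩ := h t ht s hst w hw fun i hi => hs ▸ hpi c i hi
  have hlt : c < g r := by
    rw [← sub_pos, ← hpr, ← hs, Finset.sum_apply]
    exact Finset.sum_pos' (fun v hv => mul_nonneg (hw v hv).le (K.vec_nonneg (hU ht) (hst hv) r))
      ⟨u, hu, mul_pos (hw u hu) hur⟩
  let B : Set ℝ := p ⁻¹' (⋃ s ∈ K.faces \ U, K.cone s)
  have hB : IsClosed B := (K.isClosed_biUnion_cone Set.sdiff_subset).preimage hp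
  -- After time `c` only faces outside `U` cover the ray. Closedness passes this on to time `c`
  -- itself, where the face found must contain the support `s` and hence lie in `U`.
  have hsub : Set.Ioc c (g r) ⊆ B := by
    intro e he
    obtain ⟨t', ht', hw'⟩ := K.cover (p e) (fun i => by
      by_cases hi : i = r
      · subst hi
        rw [hpr]
        linarith [he.2]
      · rw [hpi _ _ hi]
        exact hgnonneg G hG g hg i)
    simp only [B, Set.mem_preimage, Set.mem_iUnion]
    refine ⟨t', ⟨ht', fun htU => ?_⟩, hw'⟩
    have : e ∈ A := ⟨⟨hc0.trans he.1.le, he.2⟩, by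
      simp only [Set.mem_preimage, Set.mem_iUnion]
      exact ⟨t', htU, hw'⟩⟩
    exact (hmax this).not_gt he.1
  have hcB : c ∈ B := by
    have := hB.closure_subset_iff.2 hsub
    rw [closure_Ioc hlt.ne] at this
    exact this ⟨le_rfl, hlt.le⟩
  simp only [B, Set.mem_preimage, Set.mem_iUnion] at hcB
  obtain ⟨t', ⟨ht', htU⟩, w', hw', hs'⟩ := hcB
  exact htU (habs t' ht'
    (K.subset_of_sum_eq (K.down_closed (hU ht) hst) ht' hw hw' (hs.trans hs'.symm)))

/-- Every vertex on the coordinate hyperplane `i` lies in a face with a vertex off it. -/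
theorem exists_face_pos [Fintype ι] [DecidableEq ι] {v : α} (hv : {v} ∈ K.faces) (i : ι) :
    ∃ t ∈ K.faces, v ∈ t ∧ ∃ w ∈ t, 0 < K.vec w i := by
  have hvn := K.vec_nonneg hv (Finset.mem_singleton_self v)
  let U : Set (Finset α) := {t | t ∈ K.faces ∧ ∃ w ∈ t, 0 < K.vec w i}
  let p : ℝ → ι → ℝ := fun c => K.vec v + c • Pi.single i 1
  have hp : Continuous p := by fun_prop
  have hcl : IsClosed (p ⁻¹' (⋃ s ∈ U, K.cone s)) :=
    (K.isClosed_biUnion_cone fun _ h => h.1).preimage hp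
  -- Pushing `v` in direction `e_i` makes coordinate `i` positive; closedness allows the push to
  -- tend to zero.
  have hsub : Set.Ioi (0 : ℝ) ⊆ p ⁻¹' (⋃ s ∈ U, K.cone s) := by
    intro c (hc : 0 < c)
    have hpos : 0 < p c i := by simpa [p] using add_pos_of_nonneg_of_pos (hvn i) hc
    obtain ⟨t, ht, w, hw, hs⟩ := K.cover (p c) (fun j => by
      by_cases hj : j = i
      · subst hj; exact hpos.le
      · simpa [p, hj] using hvn j)
    simp only [Set.mem_preimage, Set.mem_iUnion]
    exact ⟨t, ⟨ht, K.exists_pos_of_sum_pos hw (hs ▸ hpos)⟩, w, hw, hs⟩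
  have h0 := hcl.closure_subset_iff.2 hsub
  rw [closure_Ioi] at h0
  have h0 := h0 (Set.self_mem_Ici (a := (0 : ℝ)))
  simp only [Set.mem_preimage, Set.mem_iUnion, p, zero_smul, add_zero] at h0
  obtain ⟨t, ⟨ht, hw⟩, w', hw', hs⟩ := h0
  have := K.subset_of_sum_eq (w := fun _ => 1) hv ht (fun _ _ => one_pos) hw' (by simpa using hs.symm)
  exact ⟨t, ht, this (Finset.mem_singleton_self v), hw⟩

end ConicalSubdivision

/-! ### The graph of interior edges and its coboundary map. -/

/-- If `x ≤ 0`, the first two equations force `z > 1` and `y > 1`, against the third. In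
`not_triangle` the unknowns are the weights of three vertices at a point of the ray. -/
theorem pos_of_three_mul_add_eq {x y z a₁ a₂ b₁ b₂ c₁ c₂ : ℝ} (ha₁ : 0 < a₁) (hc₁ : 0 < c₁)
    (ha₂ : 0 < a₂) (hb₂ : 0 < b₂) (hb₁ : 0 < b₁) (hc₂ : 0 < c₂)
    (h₁ : x * a₁ + z * c₁ = a₁ + c₁) (h₂ : x * a₂ + y * b₂ = a₂ + b₂)
    (h₃ : y * b₁ + z * c₂ = b₁ + c₂) : 0 < x := by
  by_contra! hx
  have hz : 1 < z := by
    by_contra! hz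
    linarith [mul_le_mul_of_nonneg_right hz hc₁.le, mul_le_mul_of_nonneg_right hx ha₁.le]
  have hy : 1 < y := by
    by_contra! hy
    linarith [mul_le_mul_of_nonneg_right hy hb₂.le, mul_le_mul_of_nonneg_right hx ha₂.le]
  linarith [mul_lt_mul_of_pos_right hy hb₁, mul_lt_mul_of_pos_right hz hc₂]

namespace ConicalSubdivision

variable {ι α : Type*} (K : ConicalSubdivision ι α)

/-- The edges that are not contained in a coordinate hyperplane. -/
def interiorEdges : Set (Finset α) :=
  {e | e ∈ K.faces ∧ e.card = 2 ∧ ∀ i, ∃ v ∈ e, 0 < K.vec v i}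

/-- `v` is a vertex whose only vanishing coordinate is the `i`-th one. -/
def IsOpposite (i : ι) (v : α) : Prop :=
  {v} ∈ K.faces ∧ K.vec v i = 0 ∧ ∀ j ≠ i, 0 < K.vec v j

/-- The vertices in the relative interior of a facet of the orthant. -/
def facetVertices : Set α := {v | ∃ i, K.IsOpposite i v}

/-- `v` and `w` are the vertices of an interior edge. -/
def Adj (v w : α) : Prop :=
  v ≠ w ∧ (∃ e ∈ K.faces, v ∈ e ∧ w ∈ e) ∧ ∀ i, 0 < K.vec v i ∨ 0 < K.vec w i

variable {K}

theorem Adj.symm {v w : α} (h : K.Adj v w) : K.Adj w v :=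
  ⟨h.1.symm, let ⟨e, he, hv, hw⟩ := h.2.1; ⟨e, he, hw, hv⟩, fun i => (h.2.2 i).symm⟩

theorem Adj.pair_mem [DecidableEq α] {v w : α} (h : K.Adj v w) : {v, w} ∈ K.interiorEdges := by
  obtain ⟨hne, ⟨e, he, hv, hw⟩, hi⟩ := h
  refine ⟨K.down_closed he ?_, Finset.card_pair hne, fun i => ?_⟩
  · simp [Finset.insert_subset_iff, hv, hw]
  · simpa using hi i

theorem exists_adj_of_mem_interiorEdges [DecidableEq α] {e : Finset α} (he : e ∈ K.interiorEdges) :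
    ∃ v w, K.Adj v w ∧ e = {v, w} := by
  obtain ⟨he, hc, hi⟩ := he
  obtain ⟨v, w, hne, rfl⟩ := Finset.card_eq_two.1 hc
  exact ⟨v, w, ⟨hne, ⟨_, he, by simp, by simp⟩, by simpa using hi⟩, rfl⟩

namespace IsOpposite

variable {i j : ι} {v w : α}

theorem adj (h : K.IsOpposite i v) {G : Finset α} (hG : G ∈ K.faces) (hv : v ∈ G) (hw : w ∈ G)
    (hi : 0 < K.vec w i) : K.Adj v w := by
  refine ⟨?_, ⟨G, hG, hv, hw⟩, fun j => ?_⟩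
  · rintro rfl
    exact hi.ne' h.2.1
  · by_cases hj : j = i
    · exact .inr (hj ▸ hi)
    · exact .inl (h.2.2 j hj)

theorem pos_of_adj (h : K.IsOpposite i v) (hvw : K.Adj v w) : 0 < K.vec w i :=
  (hvw.2.2 i).resolve_left h.2.1.not_gt

theorem ne_of_adj (h : K.IsOpposite i v) (h' : K.IsOpposite j w) (hvw : K.Adj v w) : i ≠ j := by
  rintro rfl
  exact (h.pos_of_adj hvw).ne' h'.2.1

theorem eq_of_vec_eq_zero (h : K.IsOpposite i v) (hj : K.vec v j = 0) : j = i := by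
  by_contra hne
  exact (h.2.2 j hne).ne' hj

end IsOpposite

theorem vec_eq_zero_of_not_pos {G : Finset α} (hG : G ∈ K.faces) {v : α} (hv : v ∈ G) {i : ι}
    (h : ¬ 0 < K.vec v i) : K.vec v i = 0 :=
  le_antisymm (not_lt.1 h) (K.vec_nonneg hG hv i)

/-- A function that is supported on the facet vertices and antisymmetric along the interior edges
vanishes. -/
theorem eq_zero_of_adj_add_eq_zero [Fintype ι] (hι : 3 ≤ Fintype.card ι) {f : α → ℝ}
    (hf : ∀ v ∉ K.facetVertices, f v = 0) (hadj : ∀ v w, K.Adj v w → f v + f w = 0) (v : α) :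
    f v = 0 := by
  classical
  by_contra hv
  have hmem : ∀ {u}, f u ≠ 0 → ∃ i, K.IsOpposite i u := fun {u} hu => by
    by_contra h
    exact hu (hf u h)
  obtain ⟨p, hp⟩ := hmem hv
  obtain ⟨G, hG, hvG, w, hw, hwp⟩ := K.exists_face_pos hp.1 p
  have hvw := hp.adj hG hvG hw hwp
  have hw0 : f w ≠ 0 := fun h => hv (by linarith [hadj _ _ hvw])
  obtain ⟨q, hq⟩ := hmem hw0
  -- The direction of the ray; moving along `r` leaves the coordinates `p` and `q` unchanged.
  obtain ⟨r, hr⟩ : ∃ r, r ∉ ({p, q} : Finset ι) := by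
    by_contra! h
    have := Finset.card_le_card (fun x _ => h x : (Finset.univ : Finset ι) ⊆ _)
    have := Finset.card_le_two (a := p) (b := q)
    rw [Finset.card_univ] at *
    omega
  have hrp : p ≠ r := fun h => hr (by simp [h])
  have hrq : q ≠ r := fun h => hr (by simp [h])
  have hpq := hp.ne_of_adj hq hvw
  let U : Set (Finset α) := {t | t ∈ K.faces ∧
    ∃ a ∈ t, ∃ b ∈ t, f a ≠ 0 ∧ f b ≠ 0 ∧ K.IsOpposite p a ∧ K.IsOpposite q b}
  -- A vertex with `p` positive is adjacent to `a`, so `f u = - f a`. Were `q` positive too, it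
  -- would be adjacent to `b` and `f u = - f b = f a`, forcing `f u = 0`. Hence it is a facet vertex
  -- opposite to `q`, and symmetrically.
  have hcolor : ∀ t ∈ U, ∀ u ∈ t, (0 < K.vec u p → f u ≠ 0 ∧ K.IsOpposite q u) ∧
      (0 < K.vec u q → f u ≠ 0 ∧ K.IsOpposite p u) := by
    rintro t ⟨ht, a, ha, b, hb, ha0, hb0, hap, hbq⟩ u hu
    have hab := hadj _ _ (hap.adj ht ha hb (hbq.2.2 p hpq))
    constructor
    · intro hup
      have hau := hadj _ _ (hap.adj ht ha hu hup)
      have hu0 : f u ≠ 0 := fun h => ha0 (by linarith)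
      obtain ⟨m, hm⟩ := hmem hu0
      have huq : K.vec u q = 0 := vec_eq_zero_of_not_pos ht hu fun h => by
        have := hadj _ _ (hbq.adj ht hb hu h)
        exact hu0 (by linarith)
      exact ⟨hu0, hm.eq_of_vec_eq_zero huq ▸ hm⟩
    · intro huq
      have hbu := hadj _ _ (hbq.adj ht hb hu huq)
      have hu0 : f u ≠ 0 := fun h => hb0 (by linarith)
      obtain ⟨m, hm⟩ := hmem hu0
      have hup : K.vec u p = 0 := vec_eq_zero_of_not_pos ht hu fun h => by
        have := hadj _ _ (hap.adj ht ha hu h)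
        exact hu0 (by linarith)
      exact ⟨hu0, hm.eq_of_vec_eq_zero hup ▸ hm⟩
  have hGU : G ∈ U := ⟨hG, v, hvG, w, hw, hv, hw0, hp, hq⟩
  refine K.not_absorbing (U := U) (fun t ht => ht.1) hGU
    (g := ∑ u ∈ G, (1 : ℝ) • K.vec u) ⟨fun _ => 1, fun _ _ => zero_le_one, rfl⟩ r ?_
  intro t ht s hst x hx hs
  -- Coordinates `p` and `q` stay positive along the ray, so by `hcolor` each support keeps vertices
  -- of both types, and every face around it is in `U`.
  have hpos : ∀ i ≠ r, (∃ u ∈ G, 0 < K.vec u i) → ∃ u ∈ s, 0 < K.vec u i := by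
    rintro i hi ⟨u, hu, hui⟩
    refine K.exists_pos_of_sum_pos (fun v hv => (hx v hv).le) (i := i) ?_
    rw [hs i hi, Finset.sum_apply]
    refine Finset.sum_pos' (fun v hv => ?_) ⟨u, hu, ?_⟩
    · simpa using K.vec_nonneg hG hv i
    · simpa using hui
  obtain ⟨b, hb, hbp⟩ := hpos p hrp ⟨w, hw, hwp⟩
  obtain ⟨a, ha, haq⟩ := hpos q hrq ⟨v, hvG, hp.2.2 q hpq.symm⟩
  obtain ⟨hb0, hbq⟩ := (hcolor t ht b (hst hb)).1 hbp
  obtain ⟨ha0, hap⟩ := (hcolor t ht a (hst ha)).2 haq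
  exact ⟨⟨a, ha, hap.2.2 r hrp.symm⟩,
    fun t' ht' hst' => ⟨ht', a, hst' ha, b, hst' hb, ha0, hb0, hap, hbq⟩⟩

/-- If there are as many interior edges as facet vertices, then every function on the interior
edges is the coboundary of a function on the facet vertices. -/
theorem exists_add_eq_one [Fintype ι] (hι : 3 ≤ Fintype.card ι)
    (hV : K.facetVertices.Finite)
    (hcard : K.interiorEdges.ncard = K.facetVertices.ncard) {v w : α} (hvw : K.Adj v w) :
    ∃ f : α → ℝ, (∀ u ∉ K.facetVertices, f u = 0) ∧ f v + f w = 1 ∧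
      ∀ a b, K.Adj a b → ¬ (a = v ∧ b = w) → ¬ (a = w ∧ b = v) → f a + f b = 0 := by
  classical
  have hE : K.interiorEdges.Finite := K.finite_faces.subset fun _ h => h.1
  have := hE.fintype
  have := hV.fintype
  let ext : (K.facetVertices → ℝ) →ₗ[ℝ] α → ℝ :=
    { toFun := fun f u => if h : u ∈ K.facetVertices then f ⟨u, h⟩ else 0
      map_add' := fun f g => by ext u; by_cases h : u ∈ K.facetVertices <;> simp [h]
      map_smul' := fun c f => by ext u; by_cases h : u ∈ K.facetVertices <;> simp [h] }
  let δ : (K.facetVertices → ℝ) →ₗ[ℝ] K.interiorEdges → ℝ :=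
    LinearMap.pi fun e => ∑ u ∈ (e : Finset α), LinearMap.proj u ∘ₗ ext
  have hext : ∀ f, ∀ u ∉ K.facetVertices, ext f u = 0 := fun f u hu => dif_neg hu
  have hδ : ∀ f a b, ∀ h : K.Adj a b, δ f ⟨{a, b}, h.pair_mem⟩ = ext f a + ext f b := by
    intro f a b h
    simp [δ, Finset.sum_pair h.1]
  have hinj : Function.Injective δ := by
    rw [← LinearMap.ker_eq_bot, LinearMap.ker_eq_bot']
    intro f hf
    have := eq_zero_of_adj_add_eq_zero hι (hext f) fun a b h => by rw [← hδ f a b h, hf]; rfl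
    ext u
    simpa [ext] using this u
  have hsurj : Function.Surjective δ := by
    refine (LinearMap.injective_iff_surjective_of_finrank_eq_finrank ?_).1 hinj
    rw [Module.finrank_fintype_fun_eq_card, Module.finrank_fintype_fun_eq_card,
      ← Nat.card_eq_fintype_card, ← Nat.card_eq_fintype_card]
    exact hcard.symm
  obtain ⟨f, hf⟩ := hsurj (Pi.single ⟨{v, w}, hvw.pair_mem⟩ 1)
  refine ⟨ext f, hext f, ?_, fun a b hab h1 h2 => ?_⟩
  · rw [← hδ f v w hvw, hf, Pi.single_eq_same]
  · rw [← hδ f a b hab, hf, Pi.single_eq_of_ne]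
    intro h
    have h : ({a, b} : Finset α) = {v, w} := congrArg Subtype.val h
    have ha : a ∈ ({v, w} : Finset α) := h ▸ Finset.mem_insert_self a {b}
    have hb : b ∈ ({v, w} : Finset α) :=
      h ▸ Finset.mem_insert_of_mem (Finset.mem_singleton_self b)
    rw [Finset.mem_insert, Finset.mem_singleton] at ha hb
    have := hab.1
    grind

/-! ### Forbidden configurations of independent interior edges. -/

/-- The coboundary map, from functions supported on the facet vertices to functions on the interior
edges, hits the indicator function of every interior edge. -/
def EdgesIndependent (K : ConicalSubdivision ι α) : Prop :=
  ∀ v w, K.Adj v w → ∃ f : α → ℝ, (∀ u ∉ K.facetVertices, f u = 0) ∧ f v + f w = 1 ∧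
      ∀ a b, K.Adj a b → ¬ (a = v ∧ b = w) → ¬ (a = w ∧ b = v) → f a + f b = 0

namespace EdgesIndependent

variable (H : K.EdgesIndependent) {a b c u v w z : α}
include H

/-- Here and for the longer paths below, the alternating sum of edge values depends only on `f` at
the two ends. It vanishes if neither end is a facet vertex, but equals `±1` when `f` hits the
indicator of one edge of the path. -/
theorem mem_or_mem (h : K.Adj v w) : v ∈ K.facetVertices ∨ w ∈ K.facetVertices := by
  by_contra! hc
  obtain ⟨f, hf, h1, -⟩ := H v w h
  linarith [hf v hc.1, hf w hc.2]

theorem mem_or_mem_of_path (huv : K.Adj u v) (hvw : K.Adj v w) (huw : u ≠ w) :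
    u ∈ K.facetVertices ∨ w ∈ K.facetVertices := by
  by_contra! hc
  obtain ⟨f, hf, h1, h2⟩ := H u v huv
  have := h2 v w hvw (fun h => huv.1 h.1.symm) (fun h => huw h.2.symm)
  linarith [hf u hc.1, hf w hc.2]

theorem mem_or_mem_of_path_three (huv : K.Adj u v) (hvw : K.Adj v w) (hwz : K.Adj w z)
    (huw : u ≠ w) (hvz : v ≠ z) : u ∈ K.facetVertices ∨ z ∈ K.facetVertices := by
  by_contra! hc
  obtain ⟨f, hf, h1, h2⟩ := H v w hvw
  have := h2 u v huv (fun h => huv.1 h.1) (fun h => huw h.1)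
  have := h2 w z hwz (fun h => hwz.1 h.2.symm) (fun h => hvz h.2.symm)
  linarith [hf u hc.1, hf z hc.2]

/-- The alternating sum of edge values around an even cycle is zero, whereas an edge indicator would
give `±1`. -/
theorem not_cycle_four (huv : K.Adj u v) (hvw : K.Adj v w) (hwz : K.Adj w z) (hzu : K.Adj z u)
    (huw : u ≠ w) (hvz : v ≠ z) : False := by
  obtain ⟨f, hf, h1, h2⟩ := H u v huv
  have := h2 v w hvw (fun h => huv.1 h.1.symm) (fun h => huw h.2.symm)
  have := h2 w z hwz (fun h => huw h.1.symm) (fun h => hvw.1 h.1.symm)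
  have := h2 z u hzu (fun h => hzu.1 h.1) (fun h => hvz h.1.symm)
  linarith

/-- A triangle is a path of three edges whose two ends coincide. -/
theorem mem_of_triangle (hab : K.Adj a b) (hbc : K.Adj b c) (hca : K.Adj c a) :
    a ∈ K.facetVertices :=
  or_self_iff.1 (H.mem_or_mem_of_path_three hab hbc hca hca.1.symm hab.1.symm)

/-- The indicator of `bc` forces `f a = -1/2`, hence `f u = 1/2`, which is impossible off the facet
vertices. -/
theorem mem_of_triangle_of_adj (hab : K.Adj a b) (hbc : K.Adj b c) (hca : K.Adj c a)
    (hau : K.Adj a u) : u ∈ K.facetVertices := by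
  by_contra hc
  obtain ⟨f, hf, h1, h2⟩ := H b c hbc
  have := h2 a b hab (fun h => hab.1 h.1) (fun h => hca.1 h.1.symm)
  have := h2 c a hca (fun h => hbc.1 h.1.symm) (fun h => hab.1 h.2)
  have := h2 a u hau (fun h => hab.1 h.1) (fun h => hca.1 h.1.symm)
  linarith [hf u hc]

/-- The other vertices of a face with three pairwise adjacent vertices `a`, `b`, `c` lie in the
coordinate hyperplane opposite to `a`. -/
theorem vec_eq_zero_of_triangle {p : ι} (hp : K.IsOpposite p a) {G : Finset α} (hG : G ∈ K.faces)
    (ha : a ∈ G) (hb : b ∈ G) (hc : c ∈ G) (hab : K.Adj a b) (hbc : K.Adj b c) (hca : K.Adj c a)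
    (hu : u ∈ G) (hub : u ≠ b) (huc : u ≠ c) : K.vec u p = 0 := by
  refine vec_eq_zero_of_not_pos hG hu fun h => ?_
  have hau := hp.adj hG ha hu h
  obtain ⟨m, hm⟩ := H.mem_of_triangle_of_adj hab hbc hca hau
  obtain ⟨q, hq⟩ := H.mem_of_triangle hbc hca hab
  obtain ⟨r, hr⟩ := H.mem_of_triangle hca hab hbc
  have hqr := hq.ne_of_adj hr hbc
  -- Since `q ≠ r`, the index `m` differs from one of them, so `u` is adjacent to `c` or to `b`,
  -- closing a four-cycle through `a`.
  by_cases hmq : m = q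
  · subst hmq
    exact H.not_cycle_four hau.symm hab hbc
      (hm.adj hG hu hc (hr.2.2 m hqr)).symm hub hca.1.symm
  · exact H.not_cycle_four hau.symm hca.symm hbc.symm
      (hm.adj hG hu hb (hq.2.2 m hmq)).symm huc hab.1

/-- No three vertices of a face are pairwise adjacent. -/
theorem not_triangle [Fintype ι] (hι : 4 ≤ Fintype.card ι) {G : Finset α} (hG : G ∈ K.faces)
    (ha : a ∈ G) (hb : b ∈ G) (hc : c ∈ G) (hab : K.Adj a b) (hbc : K.Adj b c)
    (hca : K.Adj c a) : False := by
  classical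
  obtain ⟨p, hp⟩ := H.mem_of_triangle hab hbc hca
  obtain ⟨q, hq⟩ := H.mem_of_triangle hbc hca hab
  obtain ⟨r, hr⟩ := H.mem_of_triangle hca hab hbc
  -- A fourth coordinate gives the ray its direction; this is where `4 ≤ Fintype.card ι` enters.
  obtain ⟨j, hj⟩ : ∃ j, j ∉ ({p, q, r} : Finset ι) := by
    by_contra! h
    have := Finset.card_le_card (fun x _ => h x : (Finset.univ : Finset ι) ⊆ _)
    have := Finset.card_le_three (a := p) (b := q) (c := r)
    rw [Finset.card_univ] at *
    omega
  simp only [Finset.mem_insert, Finset.mem_singleton, not_or] at hj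
  have hT : ({a, b, c} : Finset α) ∈ K.faces :=
    K.down_closed hG (by simp [Finset.insert_subset_iff, ha, hb, hc])
  have hsum : ∀ (w : α → ℝ) i, (∑ v ∈ {a, b, c}, w v • K.vec v) i =
      w a * K.vec a i + w b * K.vec b i + w c * K.vec c i := by
    intro w i
    rw [Finset.sum_insert (by simp [hab.1, hca.1.symm]), Finset.sum_pair hbc.1]
    simp [add_assoc]
  refine K.not_absorbing (U := {t | t ∈ K.faces ∧ {a, b, c} ⊆ t}) (fun t ht => ht.1)
    ⟨hT, subset_rfl⟩ (g := ∑ v ∈ {a, b, c}, (1 : ℝ) • K.vec v)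
    ⟨fun _ => 1, fun _ _ => zero_le_one, rfl⟩ j ?_
  rintro t ⟨ht, hTt⟩ s hst w hw hs
  have hat : a ∈ t := hTt (by simp)
  have hbt : b ∈ t := hTt (by simp)
  have hct : c ∈ t := hTt (by simp)
  let x : α → ℝ := fun v => if v ∈ s then w v else 0
  -- Other vertices of `t` vanish in the coordinates `p`, `q`, `r`, so there the point is determined
  -- by the weights of `a`, `b`, `c`. Those coordinates are constant along the ray, which keeps all
  -- three weights positive.
  have hxs : ∀ i, (∀ u ∈ t, u ≠ a → u ≠ b → u ≠ c → K.vec u i = 0) →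
      (∑ v ∈ s, w v • K.vec v) i = x a * K.vec a i + x b * K.vec b i + x c * K.vec c i := by
    intro i hi
    rw [← hsum, Finset.sum_apply, Finset.sum_apply]
    have h1 : ∑ v ∈ s, (w v • K.vec v) i = ∑ v ∈ t, (x v • K.vec v) i := by
      rw [← Finset.sum_subset hst]
      · exact Finset.sum_congr rfl fun v hv => by simp [x, hv]
      · intro v _ hv
        simp [x, hv]
    rw [h1, ← Finset.sum_subset hTt]
    intro v hv hvT
    simp only [Finset.mem_insert, Finset.mem_singleton, not_or] at hvT
    simp [hi v hv hvT.1 hvT.2.1 hvT.2.2]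
  have ep := hs p (Ne.symm hj.1)
  have eq := hs q (Ne.symm hj.2.1)
  have er := hs r (Ne.symm hj.2.2)
  rw [hsum, hxs p fun u hu _ h2 h3 =>
    H.vec_eq_zero_of_triangle hp ht hat hbt hct hab hbc hca hu h2 h3, hp.2.1] at ep
  rw [hsum, hxs q fun u hu h1 _ h3 =>
    H.vec_eq_zero_of_triangle hq ht hbt hct hat hbc hca hab hu h3 h1, hq.2.1] at eq
  rw [hsum, hxs r fun u hu h1 h2 _ =>
    H.vec_eq_zero_of_triangle hr ht hct hat hbt hca hab hbc hu h1 h2, hr.2.1] at er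
  have hbp := hp.pos_of_adj hab
  have hcp := hp.pos_of_adj hca.symm
  have haq := hq.pos_of_adj hab.symm
  have hcq := hq.pos_of_adj hbc
  have har := hr.pos_of_adj hca
  have hbr := hr.pos_of_adj hbc.symm
  have hmem : ∀ v, 0 < x v → v ∈ s := fun v hv => by
    by_contra h
    simp [x, h] at hv
  have has : a ∈ s := hmem a (pos_of_three_mul_add_eq (y := x b) (z := x c)
    haq hcq har hbr hbp hcp
    (by linarith) (by linarith) (by linarith))
  have hbs : b ∈ s := hmem b (pos_of_three_mul_add_eq (y := x a) (z := x c)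
    hbp hcp hbr har haq hcq
    (by linarith) (by linarith) (by linarith))
  have hcs : c ∈ s := hmem c (pos_of_three_mul_add_eq (y := x a) (z := x b)
    hcp hbp hcq haq har hbr
    (by linarith) (by linarith) (by linarith))
  refine ⟨⟨a, has, hp.2.2 j hj.1⟩, fun t' ht' hst' => ⟨ht', ?_⟩⟩
  simp [Finset.insert_subset_iff, hst' has, hst' hbs, hst' hcs]

end EdgesIndependent

/-- The combinatorial core: the conclusion puts every vertex of `G` except `v` on the hyperplane
`x_p = 0`. -/
theorem exists_unique_pos_of_card_eq [Fintype ι] (hι : 4 ≤ Fintype.card ι)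
    (hV : K.facetVertices.Finite)
    (hcard : K.interiorEdges.ncard = K.facetVertices.ncard) {G e : Finset α} (hG : G ∈ K.faces)
    (he : e ∈ K.interiorEdges) (heG : e ⊆ G) :
    ∃ p, ∃ v ∈ G, 0 < K.vec v p ∧ ∀ w ∈ G, w ≠ v → K.vec w p = 0 := by
  classical
  have H : K.EdgesIndependent := fun v w h => exists_add_eq_one (by omega) hV hcard h
  by_contra! hc
  have hex : ∀ p, ∀ v ∈ G, 0 < K.vec v p → ∃ u ∈ G, u ≠ v ∧ 0 < K.vec u p := by
    intro p v hv hp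
    obtain ⟨u, hu, huv, hup⟩ := hc p v hv hp
    exact ⟨u, hu, huv, (K.vec_nonneg hG hu p).lt_of_ne' hup⟩
  -- The path `u`, `v`, `w` extends by a second vertex `z` with `q` positive. The absence of
  -- triangles gives `u_q = 0` and `z_p = 0`; as `u` or `z` is a facet vertex, it is then opposite
  -- to `q` or `p` respectively, so `zu` closes a four-cycle.
  have key : ∀ u v w p q, u ∈ G → v ∈ G → w ∈ G → u ≠ w → K.IsOpposite p v →
      0 < K.vec u p → 0 < K.vec w p → K.IsOpposite q w → False := by
    intro u v w p q hu hv hw huw hp hup hwp hq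
    have hvu := hp.adj hG hv hu hup
    have hvw := hp.adj hG hv hw hwp
    have hvq := hq.pos_of_adj hvw.symm
    have huq : K.vec u q = 0 := vec_eq_zero_of_not_pos hG hu fun h =>
      H.not_triangle hι hG hu hv hw hvu.symm hvw (hq.adj hG hw hu h)
    obtain ⟨z, hz, hzv, hzq⟩ := hex q v hv hvq
    have hwz := hq.adj hG hw hz hzq
    have hzp : K.vec z p = 0 := vec_eq_zero_of_not_pos hG hz fun h =>
      H.not_triangle hι hG hv hw hz hvw hwz (hp.adj hG hv hz h).symm
    have hzu : K.Adj z u := by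
      rcases H.mem_or_mem_of_path_three hvu.symm hvw hwz huw hzv.symm with ⟨m, hm⟩ | ⟨m, hm⟩
      · obtain rfl := hm.eq_of_vec_eq_zero huq
        exact (hm.adj hG hu hz hzq).symm
      · obtain rfl := hm.eq_of_vec_eq_zero hzp
        exact hm.adj hG hz hu hup
    exact H.not_cycle_four hvu.symm hvw hwz hzu huw hzv.symm
  obtain ⟨v, w, hvw, rfl⟩ := exists_adj_of_mem_interiorEdges he
  wlog hv : v ∈ K.facetVertices generalizing v w
  · exact this w v hvw.symm (Finset.pair_comm v w ▸ he) (Finset.pair_comm v w ▸ heG)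
      ((H.mem_or_mem hvw).resolve_left hv)
  obtain ⟨p, hp⟩ := hv
  have hvG : v ∈ G := heG (by simp)
  have hwG : w ∈ G := heG (by simp)
  have hwp := hp.pos_of_adj hvw
  obtain ⟨u, hu, huw, hup⟩ := hex p w hwG hwp
  have hvu := hp.adj hG hvG hu hup
  rcases H.mem_or_mem_of_path hvu.symm hvw huw with ⟨q, hq⟩ | ⟨q, hq⟩
  · exact key w v u p q hwG hvG hu huw.symm hp hwp hup hq
  · exact key u v w p q hu hvG hwG huw hp hup hwp hq

end ConicalSubdivision

/-! ### Barycentric coordinates: from triangulations to cones. -/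

namespace LocalH

open Geometry

variable {E : Type*} [AddCommGroup E] [Module ℝ E] {Δ : Finset E}

theorem map_sum_smul (β : E →ᵃ[ℝ] (Δ → ℝ)) {s : Finset E} {w : E → ℝ} (hw : ∑ v ∈ s, w v = 1) :
    β (∑ v ∈ s, w v • v) = ∑ v ∈ s, w v • β v := by
  have hβ : ∀ x, β x = β.linear x + β 0 := fun x => congrFun (AffineMap.decomp β) x
  have hs : ∑ v ∈ s, w v • β v = ∑ v ∈ s, w v • (β.linear v + β 0) :=
    Finset.sum_congr rfl fun v _ => by rw [hβ v]
  rw [hs, hβ]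
  simp_rw [smul_add, Finset.sum_add_distrib, ← Finset.sum_smul, hw, map_sum,
    map_smul, one_smul]

theorem exists_weights_of_mem_convexHull {s : Finset E} {x : E} (hx : x ∈ convexHull ℝ (s : Set E)) :
    ∃ w : E → ℝ, (∀ v ∈ s, 0 ≤ w v) ∧ ∑ v ∈ s, w v = 1 ∧ ∑ v ∈ s, w v • v = x :=
  Finset.mem_convexHull'.1 hx

variable [DecidableEq E]

/-- An affinely independent family has barycentric coordinates that extend to the whole space. -/
theorem exists_barycentric (h : AffineIndependent ℝ ((↑) : Δ → E)) :
    ∃ β : E →ᵃ[ℝ] (Δ → ℝ), ∀ p : Δ, β p = Pi.single p 1 := by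
  obtain ⟨t, hst, hti, htop⟩ := exists_subset_affineIndependent_affineSpan_eq_top
    (s := (Δ : Set E)) h
  let b : AffineBasis t ℝ E := ⟨(↑), hti, by simpa using htop⟩
  refine ⟨AffineMap.pi fun p : Δ => b.coord ⟨p, hst p.2⟩, fun p => ?_⟩
  ext q
  have : (p : E) = b ⟨p, hst p.2⟩ := rfl
  rw [AffineMap.pi_apply, this, AffineBasis.coord_apply, Pi.single_apply]
  exact if_congr (by rw [Subtype.mk.injEq, Subtype.ext_iff]) rfl rfl

variable {β : E →ᵃ[ℝ] (Δ → ℝ)} (hβ : ∀ p : Δ, β p = Pi.single p 1)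
include hβ

theorem barycentric_apply {F : Finset E} (hF : F ⊆ Δ) {w : E → ℝ} (hw : ∑ v ∈ F, w v = 1) (p : Δ) :
    β (∑ v ∈ F, w v • v) p = if (p : E) ∈ F then w p else 0 := by
  rw [map_sum_smul β hw, Finset.sum_apply]
  have : ∀ v ∈ F, (w v • β v) p = if v = p then w p else 0 := by
    intro v hv
    rw [Pi.smul_apply, show v = ((⟨v, hF hv⟩ : Δ) : E) from rfl, hβ, Pi.single_apply]
    by_cases h : p = ⟨v, hF hv⟩
    · subst h; simp
    · have h' : v ≠ p := fun h' => h (Subtype.ext h'.symm)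
      simp [h, h']
  rw [Finset.sum_congr rfl this, Finset.sum_ite_eq']

theorem sum_barycentric_smul {x : E} (hx : x ∈ convexHull ℝ (Δ : Set E)) :
    ∑ p : Δ, β x p • (p : E) = x := by
  obtain ⟨w, hw, hw1, rfl⟩ := exists_weights_of_mem_convexHull hx
  rw [← Finset.sum_coe_sort Δ (fun v => w v • v)]
  refine Finset.sum_congr rfl fun p _ => ?_
  rw [Finset.sum_coe_sort Δ (fun v => w v • v), barycentric_apply hβ subset_rfl hw1 p, if_pos p.2]

theorem barycentric_nonneg {x : E} (hx : x ∈ convexHull ℝ (Δ : Set E)) (p : Δ) : 0 ≤ β x p := by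
  obtain ⟨w, hw, hw1, rfl⟩ := exists_weights_of_mem_convexHull hx
  rw [barycentric_apply hβ subset_rfl hw1 p, if_pos p.2]
  exact hw p p.2

theorem sum_barycentric {x : E} (hx : x ∈ convexHull ℝ (Δ : Set E)) : ∑ p : Δ, β x p = 1 := by
  obtain ⟨w, hw, hw1, rfl⟩ := exists_weights_of_mem_convexHull hx
  rw [← hw1, ← Finset.sum_coe_sort Δ w]
  refine Finset.sum_congr rfl fun p _ => ?_
  rw [barycentric_apply hβ subset_rfl hw1 p, if_pos p.2]

theorem mem_convexHull_iff_barycentric {x : E} (hx : x ∈ convexHull ℝ (Δ : Set E)) {F : Finset E}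
    (hF : F ⊆ Δ) : x ∈ convexHull ℝ (F : Set E) ↔ ∀ p : Δ, (p : E) ∉ F → β x p = 0 := by
  constructor
  · intro h p hp
    obtain ⟨w, hw, hw1, rfl⟩ := exists_weights_of_mem_convexHull h
    rw [barycentric_apply hβ hF hw1 p, if_neg hp]
  · intro h
    have hne : ∀ p : Δ, β x p ≠ 0 → (p : E) ∈ F := fun p hp => by
      by_contra hpF
      exact hp (h p hpF)
    have hmem : Finset.centerMass (Finset.univ.filter fun p : Δ => β x p ≠ 0) (β x) (fun p => (p : E))
        ∈ convexHull ℝ (F : Set E) := by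
      refine Finset.centerMass_mem_convexHull _ (fun p _ => barycentric_nonneg hβ hx p) ?_ ?_
      · rw [Finset.sum_filter_ne_zero, sum_barycentric hβ hx]
        exact one_pos
      · intro p hp
        exact hne p (Finset.mem_filter.1 hp).2
    rwa [Finset.centerMass_filter_ne_zero, Finset.centerMass_eq_of_sum_1 _ _ (sum_barycentric hβ hx),
      sum_barycentric_smul hβ hx] at hmem

/-- Coordinates of a point of the simplex sum to one and determine the point, so linear relations
between coordinate vectors become affine relations between points. -/
theorem sum_weights_eq {s t : Finset E} (hs : (s : Set E) ⊆ convexHull ℝ (Δ : Set E))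
    (ht : (t : Set E) ⊆ convexHull ℝ (Δ : Set E)) {w w' : E → ℝ}
    (h : ∑ v ∈ s, w v • β v = ∑ v ∈ t, w' v • β v) :
    ∑ v ∈ s, w v = ∑ v ∈ t, w' v ∧ ∑ v ∈ s, w v • v = ∑ v ∈ t, w' v • v := by
  have h1 : ∀ {s : Finset E} (_ : (s : Set E) ⊆ convexHull ℝ (Δ : Set E)) (w : E → ℝ),
      ∑ v ∈ s, w v = ∑ p : Δ, (∑ v ∈ s, w v • β v) p := by
    intro s hs w
    simp_rw [Finset.sum_apply, Pi.smul_apply, smul_eq_mul]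
    rw [Finset.sum_comm]
    refine Finset.sum_congr rfl fun v hv => ?_
    rw [← Finset.mul_sum, sum_barycentric hβ (hs hv), mul_one]
  have h2 : ∀ {s : Finset E} (_ : (s : Set E) ⊆ convexHull ℝ (Δ : Set E)) (w : E → ℝ),
      ∑ v ∈ s, w v • v = ∑ p : Δ, (∑ v ∈ s, w v • β v) p • (p : E) := by
    intro s hs w
    simp_rw [Finset.sum_apply, Pi.smul_apply, smul_eq_mul, Finset.sum_smul]
    rw [Finset.sum_comm]
    refine Finset.sum_congr rfl fun v hv => ?_
    simp_rw [mul_smul]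
    rw [← Finset.smul_sum, sum_barycentric_smul hβ (hs hv)]
  rw [h1 hs, h1 ht, h2 hs, h2 ht, h]
  exact ⟨rfl, rfl⟩

/-- A triangulation of a simplex gives a subdivision of the nonnegative orthant into the cones over
its faces. -/
noncomputable def IsTriangulation.conicalSubdivision {Γ : SimplicialComplex ℝ E}
    (h : IsTriangulation Γ Δ) : ConicalSubdivision Δ E where
  vec := β
  faces := {s | s = ∅ ∨ s ∈ Γ.faces}
  finite_faces := by
    have : {s | s = ∅ ∨ s ∈ Γ.faces} = {∅} ∪ Γ.faces := rfl
    rw [this]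
    exact (Set.finite_singleton _).union h.finite_faces
  down_closed := by
    rintro s t (rfl | hs) hts
    · exact .inl (Finset.subset_empty.1 hts)
    · rcases t.eq_empty_or_nonempty with rfl | ht
      · exact .inl rfl
      · exact .inr (Γ.down_closed hs hts ht)
  vec_nonneg := by
    rintro s v (rfl | hs) hv i
    · simp at hv
    · exact barycentric_nonneg hβ ((Γ.subset_space hs).trans h.space_eq.subset hv) i
  linearIndependent := by
    rintro s (rfl | hs)
    · exact linearIndependent_empty_type
    rw [Fintype.linearIndependent_iff]
    intro g hg
    let w : E → ℝ := fun v => if h : v ∈ s then g ⟨v, h⟩ else 0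
    have hgw : ∀ v : s, g v = w v := fun v => by simp [w]
    have hsub := (Γ.subset_space hs).trans h.space_eq.subset
    have := sum_weights_eq hβ (t := ∅) (w := w) (w' := 0) hsub (by simp) (by
      rw [← Finset.sum_coe_sort, Finset.sum_empty, ← hg]
      simp_rw [hgw])
    have hi := (affineIndependent_iff.1 (Γ.indep hs)) Finset.univ g
    simp only [hgw] at hi ⊢
    rw [Finset.sum_coe_sort s w, Finset.sum_coe_sort s (fun v => w v • v)] at hi
    exact fun i => hi this.1 this.2 i (Finset.mem_univ i)
  cover := by
    intro x hx
    by_cases hx0 : ∑ p, x p = 0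
    -- The origin is covered only by the cone of the empty face.
    · refine ⟨∅, .inl rfl, 0, by simp, ?_⟩
      ext p
      simpa using ((Finset.sum_eq_zero_iff_of_nonneg fun i _ => hx i).1 hx0 p (Finset.mem_univ p)).symm
    have hpos := lt_of_le_of_ne (Finset.sum_nonneg fun i _ => hx i) (Ne.symm hx0)
    set S := ∑ p, x p
    let y : E → ℝ := fun v => if h : v ∈ Δ then x ⟨v, h⟩ / S else 0
    have hxy : ∀ p : Δ, y p = x p / S := fun p => by simp [y]
    have hy1 : ∑ v ∈ Δ, y v = 1 := by
      rw [← Finset.sum_coe_sort]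
      simp_rw [hxy]
      rw [← Finset.sum_div, div_self hx0]
    have hmem : ∑ v ∈ Δ, y v • v ∈ convexHull ℝ (Δ : Set E) := by
      refine Finset.mem_convexHull'.2 ⟨y, fun v hv => ?_, hy1, rfl⟩
      rw [hxy ⟨v, hv⟩]
      exact div_nonneg (hx _) hpos.le
    rw [← h.space_eq, SimplicialComplex.mem_space_iff] at hmem
    obtain ⟨s, hs, hmem⟩ := hmem
    obtain ⟨w, hw, hw1, hwx⟩ := exists_weights_of_mem_convexHull hmem
    refine ⟨s, .inr hs, fun v => S * w v, fun v hv => mul_nonneg hpos.le (hw v hv), ?_⟩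
    simp_rw [mul_smul]
    rw [← Finset.smul_sum, ← map_sum_smul β hw1, hwx]
    ext p
    rw [Pi.smul_apply, barycentric_apply hβ subset_rfl hy1, if_pos p.2, hxy, smul_eq_mul,
      mul_div_cancel₀ _ hx0]
  subset_of_sum_eq := by
    rintro s t w w' (rfl | hs) ht hw hw' heq
    · exact Finset.empty_subset _
    have hsΔ := (Γ.subset_space hs).trans h.space_eq.subset
    have hpos : 0 < ∑ v ∈ s, w v := Finset.sum_pos hw (Γ.nonempty_of_mem_faces hs)
    rcases ht with rfl | ht
    · have := (sum_weights_eq hβ hsΔ (t := ∅) (by simp) heq).1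
      simp [this] at hpos
    have htΔ := (Γ.subset_space ht).trans h.space_eq.subset
    obtain ⟨h1, h2⟩ := sum_weights_eq hβ hsΔ htΔ heq
    have hxs : s.centerMass w id ∈ convexHull ℝ (s : Set E) :=
      Finset.centerMass_mem_convexHull _ (fun v hv => (hw v hv).le) hpos fun v hv => hv
    have hxt : s.centerMass w id ∈ convexHull ℝ (t : Set E) := by
      have : s.centerMass w id = t.centerMass w' id := by
        simp only [Finset.centerMass, id, h1, h2]
      rw [this]
      exact Finset.centerMass_mem_convexHull _ hw' (h1 ▸ hpos) fun v hv => hv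
    have hst := Γ.inter_subset_convexHull hs ht ⟨hxs, hxt⟩
    rw [← Finset.coe_inter] at hst
    obtain ⟨u, hu, hu1, hux⟩ := exists_weights_of_mem_convexHull hst
    -- The difference of two affine expressions of one point, over `s` and over `s ∩ t`. Affine
    -- independence makes it zero, so no positive weight sits outside `t`.
    let g : E → ℝ := fun v => (∑ v ∈ s, w v)⁻¹ * w v - if v ∈ t then u v else 0
    have hi := (affineIndependent_iff.1 (Γ.indep hs)) Finset.univ (fun v => g v)
    rw [Finset.sum_coe_sort s g, Finset.sum_coe_sort s (fun v => g v • v)] at hi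
    have hg1 : ∑ v ∈ s, g v = 0 := by
      rw [Finset.sum_sub_distrib, ← Finset.mul_sum, inv_mul_cancel₀ hpos.ne', ← Finset.sum_filter,
        Finset.filter_mem_eq_inter, hu1, sub_self]
    have hg2 : ∑ v ∈ s, g v • v = 0 := by
      simp_rw [g, sub_smul, mul_smul, Finset.sum_sub_distrib, ite_smul, zero_smul]
      rw [← Finset.smul_sum, ← Finset.sum_filter, Finset.filter_mem_eq_inter, hux]
      simp [Finset.centerMass]
    intro v hv
    by_contra hvt
    have := hi hg1 hg2 ⟨v, hv⟩ (Finset.mem_univ _)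
    simp only [g, if_neg hvt, sub_zero] at this
    exact (mul_pos (inv_pos.2 hpos) (hw v hv)).ne' this

end LocalH

/-! ### Low coefficients and alternating sums over subsets. -/

section

open Polynomial

theorem coeff_one_sub_X_pow_small (n : ℕ) : ((1 - X : ℤ[X]) ^ n).coeff 0 = 1 ∧
    ((1 - X : ℤ[X]) ^ n).coeff 1 = -n ∧ ((1 - X : ℤ[X]) ^ n).coeff 2 = n.choose 2 := by
  induction n with
  | zero => simp [coeff_one]
  | succ n ih =>
    obtain ⟨h0, h1, h2⟩ := ih
    have key : (1 - X : ℤ[X]) ^ (n + 1) = (1 - X) ^ n - (1 - X) ^ n * X := by ring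
    rw [key]
    refine ⟨?_, ?_, ?_⟩
    · simp [h0]
    · rw [coeff_sub, coeff_mul_X, h0, h1]; push_cast; ring
    · rw [coeff_sub, coeff_mul_X, h1, h2, Nat.choose_succ_succ' n 1]; push_cast
      rw [Nat.choose_one_right]; ring

end

namespace Finset

variable {α : Type*} [DecidableEq α] {s : Finset α}

/-- Complementation in `s` reduces this to the alternating sum over all subsets of `s \ t`. -/
theorem sum_powerset_neg_one_pow_ite_subset {t : Finset α} (ht : t ⊆ s) :
    ∑ u ∈ s.powerset, (-1 : ℤ) ^ (s.card - u.card) * (if t ⊆ u then 1 else 0) =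
      if t = s then 1 else 0 := by
  have h : ∑ u ∈ s.powerset, (-1 : ℤ) ^ (s.card - u.card) * (if t ⊆ u then 1 else 0) =
      ∑ u ∈ (s \ t).powerset, (-1 : ℤ) ^ u.card := by
    simp_rw [mul_ite, mul_one, mul_zero]
    rw [← Finset.sum_filter]
    refine Finset.sum_nbij' (fun u => s \ u) (fun u => s \ u) ?_ ?_ ?_ ?_ ?_
    · intro u hu
      simp only [mem_filter, mem_powerset] at hu ⊢
      exact sdiff_subset_sdiff subset_rfl hu.2
    · intro u hu
      simp only [mem_filter, mem_powerset] at hu ⊢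
      refine ⟨sdiff_subset, fun x hx => mem_sdiff.2 ⟨ht hx, fun hxu => (mem_sdiff.1 (hu hxu)).2 hx⟩⟩
    · intro u hu
      simp only [mem_filter, mem_powerset] at hu
      exact sdiff_sdiff_eq_self hu.1
    · intro u hu
      rw [mem_powerset] at hu
      exact sdiff_sdiff_eq_self (hu.trans sdiff_subset)
    · intro u hu
      simp only [mem_filter, mem_powerset] at hu
      rw [card_sdiff_of_subset hu.1]
  rw [h, sum_powerset_neg_one_pow_card]
  refine if_congr ?_ rfl rfl
  rw [sdiff_eq_empty_iff_subset]
  exact ⟨fun h => ht.antisymm h, fun h => h ▸ subset_rfl⟩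

theorem sum_powerset_neg_one_pow_card_filter_subset {γ : Type*} (N : Finset γ) (A : γ → Finset α)
    (hA : ∀ x ∈ N, A x ⊆ s) :
    ∑ u ∈ s.powerset, (-1 : ℤ) ^ (s.card - u.card) * ((N.filter fun x => A x ⊆ u).card : ℤ) =
      (N.filter fun x => A x = s).card := by
  simp_rw [card_filter, Nat.cast_sum, Nat.cast_ite, Nat.cast_one, Nat.cast_zero, mul_sum]
  rw [sum_comm]
  exact sum_congr rfl fun x hx => sum_powerset_neg_one_pow_ite_subset (hA x hx)

theorem sum_powerset_neg_one_pow_choose (k : ℕ) (hk : k < s.card) :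
    ∑ u ∈ s.powerset, (-1 : ℤ) ^ (s.card - u.card) * (u.card.choose k : ℤ) = 0 := by
  have := sum_powerset_neg_one_pow_card_filter_subset (s := s) (s.powersetCard k) id
    fun x hx => (mem_powersetCard.1 hx).1
  rw [filter_eq_empty_iff.2, card_empty] at this
  · rw [Nat.cast_zero] at this
    rw [← this]
    refine sum_congr rfl fun u hu => ?_
    congr 2
    rw [← card_powersetCard]
    congr 1
    ext t
    simp only [mem_powersetCard, mem_filter, id]
    exact ⟨fun h => ⟨⟨h.1.trans (mem_powerset.1 hu), h.2⟩, h.1⟩, fun h => ⟨h.2, h.1.2⟩⟩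
  · intro x hx h
    have := (mem_powersetCard.1 hx).2
    exact hk.ne' (h ▸ this)

/-- The product counts pairs `(x, p)` with `insert p (A x) ⊆ u`, so inversion leaves those with
`insert p (A x) = s`. As `A x ≠ s`, such a `p` is unique. -/
theorem sum_powerset_neg_one_pow_card_mul {γ : Type*} (N : Finset γ) (A : γ → Finset α)
    (hA : ∀ x ∈ N, A x ⊆ s) (hne : ∀ x ∈ N, A x ≠ s) :
    ∑ u ∈ s.powerset, (-1 : ℤ) ^ (s.card - u.card) *
        ((u.card : ℤ) * ((N.filter fun x => A x ⊆ u).card : ℤ)) =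
      (N.filter fun x => ∃ p ∈ s, insert p (A x) = s).card := by
  have := sum_powerset_neg_one_pow_card_filter_subset (s := s) (N ×ˢ s)
    (fun x => insert x.2 (A x.1)) fun x hx => by
      rw [mem_product] at hx
      exact insert_subset hx.2 (hA x.1 hx.1)
  trans ∑ u ∈ s.powerset, (-1 : ℤ) ^ (s.card - u.card) *
    (((N ×ˢ s).filter fun x => insert x.2 (A x.1) ⊆ u).card : ℤ)
  · refine sum_congr rfl fun u hu => ?_
    rw [mul_comm (u.card : ℤ), ← Nat.cast_mul, ← card_product]
    congr 3
    ext ⟨x, p⟩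
    simp only [mem_product, mem_filter, insert_subset_iff]
    exact ⟨fun h => ⟨⟨h.1.1, mem_powerset.1 hu h.2⟩, h.2, h.1.2⟩,
      fun h => ⟨⟨h.1.1, h.2.2⟩, h.2.1⟩⟩
  · rw [this]
    congr 1
    refine card_nbij (fun x => x.1) ?_ ?_ ?_
    · intro x hx
      rw [mem_coe, mem_filter, mem_product] at hx
      exact mem_coe.2 <| mem_filter.2 ⟨hx.1.1, x.2, hx.1.2, hx.2⟩
    · rintro ⟨x, p⟩ hx ⟨y, q⟩ hy (rfl : x = y)
      simp only [coe_filter, mem_product, Set.mem_ofPred_eq] at hx hy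
      have hp : p ∉ A x := fun h => hne x hx.1.1 (by rw [← hx.2, insert_eq_of_mem h])
      have : p ∈ insert q (A x) := by rw [hy.2, ← hx.2]; exact mem_insert_self _ _
      rw [(mem_insert.1 this).resolve_right hp]
    · intro x hx
      simp only [coe_filter, Set.mem_ofPred_eq] at hx
      obtain ⟨hx, p, hp, h⟩ := hx
      exact ⟨(x, p), by simp [hx, hp, h], rfl⟩

end Finset

namespace LocalH

open Polynomial Geometry

variable {E : Type*} [AddCommGroup E] [Module ℝ E]

theorem faceCount_zero (K : SimplicialComplex ℝ E) : faceCount K 0 = 1 := by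
  have : {s : Finset E | (s = ∅ ∨ s ∈ K.faces) ∧ s.card = 0} = {∅} := by
    ext s
    simp only [Finset.card_eq_zero, Set.mem_ofPred_eq, Set.mem_singleton_iff]
    tauto
  rw [faceCount, this, Set.ncard_singleton]

theorem hPoly_coeff (K : SimplicialComplex ℝ E) (n k : ℕ) :
    (hPoly K n).coeff k = ∑ i ∈ Finset.range (n + 1),
      (faceCount K i : ℤ) * (X ^ i * (1 - X) ^ (n - i) : ℤ[X]).coeff k := by
  simp only [hPoly, finsetSum_coeff, ← Int.cast_natCast (R := ℤ[X]), ← C_eq_intCast, coeff_C_mul,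
    Int.cast_id]

theorem hPoly_coeff_one (K : SimplicialComplex ℝ E) (n : ℕ) (h : n < 1 → faceCount K 1 = 0) :
    (hPoly K n).coeff 1 = faceCount K 1 - n := by
  rw [hPoly_coeff]
  rcases n with _ | n
  · simp [h]
  · rw [Finset.sum_range_succ', Finset.sum_range_succ', Finset.sum_eq_zero]
    · have hX : ∀ (p : ℤ[X]) i, (X * p).coeff (i + 1) = p.coeff i := coeff_X_mul
      have h0 := coeff_one_sub_X_pow_small n
      have h1 := (coeff_one_sub_X_pow_small (n + 1)).2.1
      simp [faceCount_zero, h0, h1, hX _ 0]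
      ring
    · intro i _
      rw [coeff_X_pow_mul', if_neg (by omega), mul_zero]

/-- The defining sum stops at `i = n`, so for small `n` the omitted face counts must vanish. -/
theorem hPoly_coeff_two (K : SimplicialComplex ℝ E) (n : ℕ) (h1 : n < 1 → faceCount K 1 = 0)
    (h2 : n < 2 → faceCount K 2 = 0) :
    (hPoly K n).coeff 2 = faceCount K 2 - (n * faceCount K 1 - faceCount K 1) + n.choose 2 := by
  rw [hPoly_coeff]
  rcases n with _ | _ | n
  · simp [h1, h2]
  · simp [h2, Finset.sum_range_succ, faceCount_zero, coeff_X, coeff_one]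
  · rw [Finset.sum_range_succ', Finset.sum_range_succ', Finset.sum_range_succ', Finset.sum_eq_zero]
    · have hX : ∀ (p : ℤ[X]) i, (X * p).coeff (i + 1) = p.coeff i := coeff_X_mul
      have h0 := coeff_one_sub_X_pow_small n
      have h1 := (coeff_one_sub_X_pow_small (n + 1)).2.1
      have h2 := (coeff_one_sub_X_pow_small (n + 2)).2.2
      simp [faceCount_zero, h0, h1, h2, hX _ 1, coeff_X_pow_mul']
      ring
    · intro i _
      rw [coeff_X_pow_mul', if_neg (by omega), mul_zero]

theorem localH_coeff (K : SimplicialComplex ℝ E) (Δ : Finset E) (k : ℕ) :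
    (localH K Δ).coeff k = ∑ F ∈ Δ.powerset,
      (-1) ^ (Δ.card - F.card) * (hPoly (restrict K F) F.card).coeff k := by
  have h : ∀ m : ℕ, (-1 : ℤ[X]) ^ m = C ((-1) ^ m) := by simp
  simp only [localH, finsetSum_coeff, h, coeff_C_mul]

theorem faceCount_restrict_eq_zero (K : SimplicialComplex ℝ E) {F : Finset E} {i : ℕ} (hi : 0 < i)
    (hF : F.card < i) (hF' : F.card < 2) : faceCount (restrict K F) i = 0 := by
  have : {s : Finset E | (s = ∅ ∨ s ∈ (restrict K F).faces) ∧ s.card = i} = ∅ := by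
    rw [Set.eq_empty_iff_forall_notMem]
    rintro s ⟨rfl | hs, hc⟩
    · simp at hc; omega
    · have hsF : s ⊆ F := by
        rw [← Finset.coe_subset]
        refine hs.2.trans ?_
        have : (F : Set E).Subsingleton :=
          (Set.subsingleton_coe _).1 (Finset.card_le_one_iff_subsingleton_coe.1 (by omega))
        exact this.convex.convexHull_eq.subset
      have := Finset.card_le_card hsF
      omega
  rw [faceCount, this, Set.ncard_empty]

end LocalH

/-! ### Counting interior edges and facet vertices by carriers. -/

namespace LocalH

open Geometry

variable {E : Type*} [AddCommGroup E] [Module ℝ E] {Δ : Finset E}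

/-- The vertices of the simplex `Δ` at which some vertex of `s` has a positive barycentric
coordinate. -/
noncomputable def carrier (β : E →ᵃ[ℝ] (Δ → ℝ)) (s : Finset E) : Finset E :=
  open Classical in
  (Finset.univ.filter fun p : Δ => ∃ v ∈ s, 0 < β v p).map (Function.Embedding.subtype _)

variable {β : E →ᵃ[ℝ] (Δ → ℝ)}

theorem coe_mem_carrier {s : Finset E} {p : Δ} : (p : E) ∈ carrier β s ↔ ∃ v ∈ s, 0 < β v p := by
  simp [carrier]

theorem carrier_subset (s : Finset E) : carrier β s ⊆ Δ := by
  intro p hp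
  obtain ⟨q, -, rfl⟩ := Finset.mem_map.1 hp
  exact q.2

theorem carrier_eq_iff {s : Finset E} : carrier β s = Δ ↔ ∀ p, ∃ v ∈ s, 0 < β v p := by
  constructor
  · intro h p
    exact coe_mem_carrier.1 (h.symm ▸ p.2)
  · exact fun h => (carrier_subset s).antisymm fun p hp => coe_mem_carrier (p := ⟨p, hp⟩).2 (h _)

variable [DecidableEq E] (hβ : ∀ p : Δ, β p = Pi.single p 1)
include hβ

theorem carrier_subset_iff {s F : Finset E} (hs : (s : Set E) ⊆ convexHull ℝ (Δ : Set E))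
    (hF : F ⊆ Δ) : carrier β s ⊆ F ↔ (s : Set E) ⊆ convexHull ℝ (F : Set E) := by
  constructor
  · intro h v hv
    rw [mem_convexHull_iff_barycentric hβ (hs hv) hF]
    intro p hp
    by_contra hne
    exact hp (h (coe_mem_carrier.2 ⟨v, hv, (barycentric_nonneg hβ (hs hv) p).lt_of_ne' hne⟩))
  · intro h q hq
    lift q to Δ using carrier_subset s hq
    obtain ⟨v, hv, hp⟩ := coe_mem_carrier.1 hq
    by_contra hqF
    exact hp.ne' ((mem_convexHull_iff_barycentric hβ (hs hv) hF).1 (h hv) q hqF)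

theorem carrier_eq_of_isCarriedBy {s F : Finset E} (h : IsCarriedBy Δ s F) : carrier β s = F := by
  have hs := h.2.1.trans (convexHull_mono (Finset.coe_subset.2 h.1))
  exact ((carrier_subset_iff hβ hs h.1).2 h.2.1).antisymm
    (h.2.2 _ (carrier_subset s) ((carrier_subset_iff hβ hs (carrier_subset s)).1 subset_rfl))

variable {Γ : SimplicialComplex ℝ E} (hΓ : IsTriangulation Γ Δ)

theorem faceCount_restrict {F : Finset E} (hF : F ⊆ Δ) {i : ℕ} (hi : 0 < i) :
    faceCount (restrict Γ F) i =
      ((hΓ.finite_faces.toFinset.filter fun s => s.card = i).filter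
        fun s => carrier β s ⊆ F).card := by
  rw [faceCount, ← Set.ncard_coe_finset]
  congr 1
  ext s
  simp only [Set.mem_ofPred_eq, Finset.coe_filter, Finset.mem_filter, Set.Finite.mem_toFinset]
  constructor
  · rintro ⟨rfl | hs, hc⟩
    · simp at hc; omega
    · exact ⟨⟨hs.1, hc⟩, (carrier_subset_iff hβ
        ((Γ.subset_space hs.1).trans hΓ.space_eq.subset) hF).2 hs.2⟩
  · rintro ⟨⟨hs, hc⟩, h⟩
    exact ⟨.inr ⟨hs, (carrier_subset_iff hβ
      ((Γ.subset_space hs).trans hΓ.space_eq.subset) hF).1 h⟩, hc⟩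

/-- The linear coefficient of the local `h`-polynomial counts the interior vertices. -/
theorem localH_coeff_one (hd : 1 < Δ.card) : (localH Γ Δ).coeff 1 =
    ((hΓ.finite_faces.toFinset.filter fun s => s.card = 1).filter
      fun s => carrier β s = Δ).card := by
  rw [localH_coeff, ← Finset.sum_powerset_neg_one_pow_card_filter_subset _ (carrier β)
    fun s _ => carrier_subset s, ← sub_eq_zero, ← Finset.sum_sub_distrib,
    ← neg_eq_zero, ← Finset.sum_neg_distrib, ← Finset.sum_powerset_neg_one_pow_choose 1 hd]
  refine Finset.sum_congr rfl fun F hF => ?_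
  rw [hPoly_coeff_one _ _ fun h => faceCount_restrict_eq_zero Γ one_pos h (by omega),
    faceCount_restrict hβ hΓ (Finset.mem_powerset.1 hF) one_pos, Nat.choose_one_right]
  ring

/-- If there are no interior vertices, then the quadratic coefficient of the local `h`-polynomial
is the number of interior edges minus the number of vertices in the interior of facets. -/
theorem localH_coeff_two (hd : 2 < Δ.card)
    (h : ∀ s ∈ hΓ.finite_faces.toFinset.filter fun s => s.card = 1, carrier β s ≠ Δ) :
    (localH Γ Δ).coeff 2 =
      (((hΓ.finite_faces.toFinset.filter fun s => s.card = 2).filter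
        fun s => carrier β s = Δ).card : ℤ) -
      ((hΓ.finite_faces.toFinset.filter fun s => s.card = 1).filter
        fun s => ∃ p ∈ Δ, insert p (carrier β s) = Δ).card := by
  -- The binomial term (`e0`) and the vertex count (`e1`, no interior vertices) cancel. The edge
  -- count leaves the interior edges (`e2`), and `F.card` times the vertex count leaves the facet
  -- vertices (`e3`).
  have e0 := Finset.sum_powerset_neg_one_pow_choose 2 hd
  have e1 := Finset.sum_powerset_neg_one_pow_card_filter_subset (s := Δ)
    (hΓ.finite_faces.toFinset.filter fun s => s.card = 1) (carrier β) fun s _ => carrier_subset s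
  have e2 := Finset.sum_powerset_neg_one_pow_card_filter_subset (s := Δ)
    (hΓ.finite_faces.toFinset.filter fun s => s.card = 2) (carrier β) fun s _ => carrier_subset s
  have e3 := Finset.sum_powerset_neg_one_pow_card_mul (s := Δ)
    (hΓ.finite_faces.toFinset.filter fun s => s.card = 1) (carrier β)
    (fun s _ => carrier_subset s) h
  rw [Finset.filter_eq_empty_iff.2 fun s hs => h s hs, Finset.card_empty, Nat.cast_zero] at e1
  have key : ∀ F ∈ Δ.powerset,
      (-1 : ℤ) ^ (Δ.card - F.card) * (hPoly (restrict Γ F) F.card).coeff 2 =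
        (-1) ^ (Δ.card - F.card) * (((hΓ.finite_faces.toFinset.filter fun s => s.card = 2).filter
          fun s => carrier β s ⊆ F).card : ℤ) -
        (-1) ^ (Δ.card - F.card) * (F.card *
          (((hΓ.finite_faces.toFinset.filter fun s => s.card = 1).filter
            fun s => carrier β s ⊆ F).card : ℤ)) +
        (-1) ^ (Δ.card - F.card) * (((hΓ.finite_faces.toFinset.filter fun s => s.card = 1).filter
          fun s => carrier β s ⊆ F).card : ℤ) +
        (-1) ^ (Δ.card - F.card) * (F.card.choose 2 : ℤ) := by
    intro F hF
    rw [hPoly_coeff_two _ _ (fun h => faceCount_restrict_eq_zero Γ one_pos h (by omega))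
      (fun h => faceCount_restrict_eq_zero Γ two_pos h h),
      faceCount_restrict hβ hΓ (Finset.mem_powerset.1 hF) one_pos,
      faceCount_restrict hβ hΓ (Finset.mem_powerset.1 hF) two_pos]
    ring
  rw [localH_coeff, Finset.sum_congr rfl key, Finset.sum_add_distrib, Finset.sum_add_distrib,
    Finset.sum_sub_distrib, e0, e1, e2, e3, add_zero, add_zero]

theorem card_interiorEdges : (hΓ.conicalSubdivision hβ).interiorEdges.ncard =
    ((hΓ.finite_faces.toFinset.filter fun s => s.card = 2).filter
      fun s => carrier β s = Δ).card := by
  rw [← Set.ncard_coe_finset]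
  congr 1
  ext s
  simp only [Finset.coe_filter, Finset.mem_filter, Set.Finite.mem_toFinset, Set.mem_ofPred_eq,
    carrier_eq_iff, ConicalSubdivision.interiorEdges]
  constructor
  · rintro ⟨rfl | hs, hc, h⟩
    · simp at hc
    · exact ⟨⟨hs, hc⟩, h⟩
  · rintro ⟨⟨hs, hc⟩, h⟩
    exact ⟨.inr hs, hc, h⟩

theorem card_facetVertices
    (h : ∀ s ∈ hΓ.finite_faces.toFinset.filter fun s => s.card = 1, carrier β s ≠ Δ) :
    (hΓ.conicalSubdivision hβ).facetVertices.ncard =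
      ((hΓ.finite_faces.toFinset.filter fun s => s.card = 1).filter
        fun s => ∃ p ∈ Δ, insert p (carrier β s) = Δ).card := by
  rw [← Set.ncard_coe_finset, ← Set.ncard_image_of_injective _ Finset.singleton_injective]
  congr 1
  ext s
  simp only [Finset.coe_filter, Finset.mem_filter, Set.Finite.mem_toFinset, Set.mem_ofPred_eq,
    Set.mem_image] at h ⊢
  constructor
  · rintro ⟨v, ⟨p, hv, hp, hpos⟩, rfl⟩
    have hv : {v} ∈ Γ.faces := hv.resolve_left (Finset.singleton_ne_empty v)
    refine ⟨⟨hv, Finset.card_singleton v⟩, p, p.2,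
      (Finset.insert_subset p.2 (carrier_subset _)).antisymm fun q hq => ?_⟩
    lift q to Δ using hq
    by_cases hqp : q = p
    · exact hqp ▸ Finset.mem_insert_self _ _
    · exact Finset.mem_insert_of_mem (coe_mem_carrier.2 ⟨v, by simp, hpos q hqp⟩)
  · rintro ⟨⟨hs, hc⟩, p, hp, hins⟩
    obtain ⟨v, rfl⟩ := Finset.card_eq_one.1 hc
    have hv : v ∈ convexHull ℝ (Δ : Set E) :=
      (Γ.subset_space hs).trans hΓ.space_eq.subset (Finset.mem_singleton_self v)
    refine ⟨v, ⟨⟨p, hp⟩, .inr hs, ?_, fun j hj => ?_⟩, rfl⟩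
    -- A positive coordinate at `p` would make the carrier all of `Δ`, i.e. `v` an interior vertex.
    · by_contra hne
      refine h _ ⟨hs, hc⟩ ?_
      rw [← Finset.insert_eq_of_mem (coe_mem_carrier (β := β) (s := {v}) (p := ⟨p, hp⟩) |>.2
        ⟨v, by simp, (barycentric_nonneg hβ hv _).lt_of_ne' hne⟩), hins]
    · have : (j : E) ∈ insert p (carrier β {v}) := hins.symm ▸ j.2
      have := (Finset.mem_insert.1 this).resolve_left fun h => hj (Subtype.ext h)
      obtain ⟨u, hu, hpos⟩ := coe_mem_carrier.1 this
      rw [Finset.mem_singleton.1 hu] at hpos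
      exact hpos

end LocalH

theorem mainTheorem8 {E : Type*} [AddCommGroup E] [Module ℝ E] (d : ℕ) (hd : 4 ≤ d)
    (Δ : Finset E) (hΔ : Δ.card = d) (Γ : Geometry.SimplicialComplex ℝ E)
    (hΓ : LocalH.IsTriangulation Γ Δ)
    (h1 : (LocalH.localH Γ Δ).coeff 1 = 0) (h2 : (LocalH.localH Γ Δ).coeff 2 = 0)
    (G : Finset E) (hG : G ∈ Γ.facets)
    (hGe : ∃ e, e ⊆ G ∧ LocalH.IsInteriorEdge Γ Δ e) :
    LocalH.IsPyramid Δ G := by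
  classical
  obtain ⟨β, hβ⟩ := LocalH.exists_barycentric hΓ.affineIndependent
  let K := hΓ.conicalSubdivision hβ
  rw [LocalH.localH_coeff_one hβ hΓ (by omega), Nat.cast_eq_zero, Finset.card_eq_zero,
    Finset.filter_eq_empty_iff] at h1
  rw [LocalH.localH_coeff_two hβ hΓ (by omega) h1, sub_eq_zero, Nat.cast_inj,
    ← LocalH.card_interiorEdges hβ hΓ, ← LocalH.card_facetVertices hβ hΓ h1] at h2
  have hV : K.facetVertices.Finite := by
    refine Set.Finite.of_finite_image (f := fun v => ({v} : Finset E))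
      (K.finite_faces.subset ?_) Finset.singleton_injective.injOn
    rintro _ ⟨v, ⟨p, hv⟩, rfl⟩
    exact hv.1
  obtain ⟨e, heG, he, hec, hcarr⟩ := hGe
  obtain ⟨p, v, hv, hvp, hw⟩ := ConicalSubdivision.exists_unique_pos_of_card_eq (K := K)
    (by rw [Fintype.card_coe]; omega) hV h2 (.inr hG.1) (e := e)
    ⟨.inr he, hec, LocalH.carrier_eq_iff.1 (LocalH.carrier_eq_of_isCarriedBy hβ hcarr)⟩ heG
  have hGΔ : (G : Set E) ⊆ convexHull ℝ (Δ : Set E) :=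
    (Γ.subset_space hG.1).trans hΓ.space_eq.subset
  -- The facet of the simplex opposite to `p` is where the barycentric coordinate `p` vanishes.
  refine ⟨Δ.erase p, Finset.erase_ssubset p.2, v, hv, fun h => ?_, fun w hwG hwv => ?_⟩
  · rw [LocalH.mem_convexHull_iff_barycentric hβ (hGΔ hv) (Finset.erase_subset _ _)] at h
    exact hvp.ne' (h p (Finset.notMem_erase _ _))
  · rw [LocalH.mem_convexHull_iff_barycentric hβ (hGΔ hwG) (Finset.erase_subset _ _)]
    intro q hq
    have : q = p := by
      by_contra hne
      exact hq (Finset.mem_erase.2 ⟨fun h => hne (Subtype.ext h), q.2⟩)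
    exact this ▸ hw w hwG hwv
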